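/- Let $p,q\ge 0$ be real numbers with $0<p+q\le 1$. The envelope GPCA $\widehat E_{p,q}$ acts on configurations $\eta\in\{0,?,1\}^{\mathbb Z}$ (with the product $\sigma$-algebra) as follows: given $\eta$, the cells $n\in\mathbb Z$ are updated independently, and the new symbol of cell $n$ depends on the ordered pair $(a_0,a_1)$, where $(a_0,a_1)=(\eta(n),\eta(n+1))$ if $n$ is even and $(a_0,a_1)=(\eta(n+1),\eta(n+2))$ if $n$ is odd. If $(a_0,a_1)=(0,0)$, the new symbol is $0$ with probability $p$ and $1$ with probability $1-p$; if $a_0=1$ or $a_1=1$, it is $0$ with probability $1-q$ and $1$ with probability $q$; in the remaining cases (both in $\{0,?\}$ and not both $0$) it is $0$ with probability $p$, $1$ with probability $q$ and $?$ with probability $1-p-q$. For a probability measure $\mu$ on $\{0,?,1\}^{\mathbb Z}$ let $\widehat E_{p,q}\mu$ be the law of the updated configuration when the initial one has law $\mu$; $\mu$ is stationary if $\widehat E_{p,q}\mu=\mu$. Theorem. The polynomial $x^5-5x^4+9x^3-8x^2+6x-1$ has a unique real root $p_0$, and $p_0\approx 0.215$ (that is, $|p_0-0.215|<0.0005$). If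 either (i) $q=0$ and $p>p_0$, or (ii) $q>\max\left\{\frac{-\sqrt{p^2+2}-p+2}{2},\,0\right\}$, then $\widehat E_{p,q}$ has no stationary distribution $\mu$ that assigns positive probability to the occurrence of $?$, i.e. none with $\mu(\{\eta:\exists n\in\mathbb Z,\ \eta(n)=\,?\})>0$. -/

import Mathlib

open MeasureTheory

namespace EnvelopeGPCA

/-- The alphabet `{0, ?, 1}`. -/
inductive Sym : Type
  | zero
  | unk
  | one
  deriving DecidableEq

/-- The alphabet carries the discrete sigma-algebra. -/
instance instMeasurableSpaceSym : MeasurableSpace Sym := ⊤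

instance instDiscreteMeasurableSpaceSym : DiscreteMeasurableSpace Sym := ⟨fun _ => trivial⟩

instance instCountableSym : Countable Sym :=
  Function.Injective.countable (f := fun s : Sym => match s with
    | .zero => (0 : ℕ)
    | .unk => 1
    | .one => 2) (by intro a b h; cases a <;> cases b <;> simp_all)

/-- Configurations `{0, ?, 1}^ℤ`, with the product sigma-algebra (generated by cylinder sets). -/
abbrev Config : Type := ℤ → Sym

/-- The stochastic matrix `φ̂_{p,q}(a₀, a₁, b)` of the envelope: the probability that a cell takes
the value `b` when its two neighbours carry the symbols `a₀` and `a₁`. -/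
noncomputable def rule (p q : ℝ) (a₀ a₁ b : Sym) : ℝ :=
  if a₀ = Sym.zero ∧ a₁ = Sym.zero then
    match b with
    | .zero => p
    | .unk => 0
    | .one => 1 - p
  else if a₀ = Sym.one ∨ a₁ = Sym.one then
    match b with
    | .zero => 1 - q
    | .unk => 0
    | .one => q
  else
    match b with
    | .zero => p
    | .unk => 1 - p - q
    | .one => q

/-- The law on the alphabet given by a row of the stochastic matrix. -/
noncomputable def cellLaw (p q : ℝ) (a₀ a₁ : Sym) : Measure Sym :=
  ENNReal.ofReal (rule p q a₀ a₁ Sym.zero) • Measure.dirac Sym.zero +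
  ENNReal.ofReal (rule p q a₀ a₁ Sym.unk) • Measure.dirac Sym.unk +
  ENNReal.ofReal (rule p q a₀ a₁ Sym.one) • Measure.dirac Sym.one

/-- The smallest element of the neighbourhood: `{0, 1}` for even cells, `{1, 2}` for odd cells. -/
def offset (n : ℤ) : ℤ := if Even n then 0 else 1

/-- The law of the random configuration `Ê_{p,q} η`: the cells are updated independently, the cell
`n` according to the symbols of `η` at its two neighbours. -/
noncomputable def step (p q : ℝ) (η : Config) : Measure Config :=
  Measure.infinitePi fun n : ℤ => cellLaw p q (η (n + offset n)) (η (n + offset n + 1))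

/-- The law `Ê_{p,q} μ` of the configuration obtained by updating a random configuration with
law `μ`. -/
noncomputable def push (p q : ℝ) (μ : Measure Config) : Measure Config := μ.bind (step p q)

/-- `μ` is a stationary distribution of `Ê_{p,q}`: a probability measure with `Ê_{p,q} μ = μ`. -/
def IsStationary (p q : ℝ) (μ : Measure Config) : Prop :=
  IsProbabilityMeasure μ ∧ push p q μ = μ

/-! For admissible parameters the rows of the matrix are probability laws and the one-step law
depends measurably on the configuration, so that the product and `bind` above are genuine. -/

theorem isProbabilityMeasure_cellLaw {p q : ℝ} (hp : 0 ≤ p) (hq : 0 ≤ q) (hpq : p + q ≤ 1)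
    (a₀ a₁ : Sym) : IsProbabilityMeasure (cellLaw p q a₀ a₁) := by
  constructor
  simp only [cellLaw, Measure.add_apply, Measure.smul_apply, measure_univ, smul_eq_mul, mul_one]
  have h : ∀ b, 0 ≤ rule p q a₀ a₁ b := by
    intro b
    unfold rule
    split_ifs <;> cases b <;> simp <;> linarith
  rw [← ENNReal.ofReal_add (h _) (h _), ← ENNReal.ofReal_add (add_nonneg (h _) (h _)) (h _)]
  have : rule p q a₀ a₁ Sym.zero + rule p q a₀ a₁ Sym.unk + rule p q a₀ a₁ Sym.one = 1 := by
    unfold rule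
    split_ifs <;> ring
  rw [this, ENNReal.ofReal_one]

theorem isProbabilityMeasure_step {p q : ℝ} (hp : 0 ≤ p) (hq : 0 ≤ q) (hpq : p + q ≤ 1)
    (η : Config) : IsProbabilityMeasure (step p q η) := by
  have hprob := isProbabilityMeasure_cellLaw hp hq hpq
  unfold step
  infer_instance

theorem step_pi {p q : ℝ} (hp : 0 ≤ p) (hq : 0 ≤ q) (hpq : p + q ≤ 1) (η : Config)
    (s : Finset ℤ) (t : ℤ → Set Sym) :
    step p q η ((s : Set ℤ).pi t) =
      ∏ n ∈ s, cellLaw p q (η (n + offset n)) (η (n + offset n + 1)) (t n) := by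
  have hprob := isProbabilityMeasure_cellLaw hp hq hpq
  unfold step
  rw [Measure.infinitePi_pi]
  intro i _
  exact MeasurableSet.of_discrete

theorem measurable_step_pi {p q : ℝ} (hp : 0 ≤ p) (hq : 0 ≤ q) (hpq : p + q ≤ 1)
    (s : Finset ℤ) (t : ℤ → Set Sym) :
    Measurable fun η : Config => step p q η ((s : Set ℤ).pi t) := by
  simp only [step_pi hp hq hpq]
  refine Finset.measurable_prod _ fun n _ => ?_
  have hf : Measurable fun a : Sym × Sym => cellLaw p q a.1 a.2 (t n) := measurable_of_countable _
  have hg : Measurable fun η : Config => (η (n + offset n), η (n + offset n + 1)) :=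
    Measurable.prodMk (measurable_pi_apply _) (measurable_pi_apply _)
  generalize n + offset n = m at hg ⊢
  exact Measurable.comp (f := fun η : Config => (η m, η (m + 1))) hf hg

theorem measurable_step {p q : ℝ} (hp : 0 ≤ p) (hq : 0 ≤ q) (hpq : p + q ≤ 1) :
    Measurable (step p q) := by
  have hstep := isProbabilityMeasure_step hp hq hpq
  have hpi : IsPiSystem (squareCylinders fun _ : ℤ => {s : Set Sym | MeasurableSet s}) :=
    isPiSystem_squareCylinders (fun _ => MeasurableSpace.isPiSystem_measurableSet) (by simp)
  refine Measurable.measure_of_isPiSystem_of_isProbabilityMeasure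
    generateFrom_squareCylinders.symm hpi ?_
  intro S hS
  obtain ⟨s, t, -, h⟩ := hS
  rw [h]
  exact measurable_step_pi hp hq hpq s t

end EnvelopeGPCA

/-!
Sort the pairs of cells `(2k, 2k + 1)` into three types: both entries `0`; some entry `1`; neither,
so that the pair contains `?` and no `1`. Cells `2k - 1` and `2k` are both updated from the pair
`(2k, 2k + 1)`, and only its type matters. Hence the types of the pairs form a probabilistic
cellular automaton in their own right: given the configuration, the new types are independent, and
the new type at `k` depends on the old types at `k` and `k + 1` (`step_real_blocks`). For a
stationary `μ` the expectation of `f` at three consecutive types therefore equals the expectation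
of `transfer p q f` at four consecutive types (`IsStationary.integral_transfer`). Write `u k` for
the probability that pair `k` has type `?`. A cell can become `?` only if it is updated from such a
pair, so it suffices to show `u = 0` (`IsStationary.exists_unk_eq_zero`).

In case (ii) the hypothesis on `q` gives `2 (1 - q) (1 - p - q) < 1`, because
`(2 - p - 2 q)² - p² = 4 (1 - q) (1 - p - q)`. A pair of type `?` has an entry `?`,
which comes from a pair of type `?` and costs a factor `1 - p - q`, while the other entry is not
`1`, which costs a factor at most `1 - q`. So `u k ≤ (1 - q) (1 - p - q) (u k + u (k + 1))`, and the
supremum of `u` is zero. No translation invariance of `μ` is needed.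

In case (i) a finer potential is used. There is a function `weight` of three types and a corrector
`corr`, both vanishing unless a type `?` is present, such that pointwise on four types
`transfer weight + 1[first type is ?] ≤ weight + (shifted corr - corr)` as soon as `p ≥ 0.2145`
(`transfer_weight_le`); note that `p₀ > 0.2145`. Integrating against `μ`, stationarity cancels the
weights and leaves `u k ≤ G (k + 1) - G k`, where `G` is the expected corrector and
`|G k| ≤ C (u k + u (k + 1) + u (k + 2))`. So `G` is monotone and bounded, its increments tend to
zero at both ends of `ℤ`, hence so do `u` and then `G` itself. A monotone function that tends to
zero at both ends is zero, and `u = 0` (`eq_zero_of_le_sub`). Again `μ` need not be translation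
invariant: the telescoping corrector replaces it.
-/

namespace EnvelopeGPCA

instance instFintypeSym : Fintype Sym :=
  ⟨{.zero, .unk, .one}, fun a => by cases a <;> simp⟩

theorem sum_sym {M : Type*} [AddCommMonoid M] (f : Sym → M) :
    ∑ a, f a = f .zero + (f .unk + f .one) := by
  change ∑ a ∈ {Sym.zero, Sym.unk, Sym.one}, f a = _
  rw [Finset.sum_insert (by simp), Finset.sum_insert (by simp), Finset.sum_singleton]

/-! ### The automaton of pair types -/

/-- The type of a pair of symbols, with the symbols reused as labels: `zero` for `(0, 0)`, `one`
when some entry is `1`, and `unk` otherwise. -/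
def kind (a b : Sym) : Sym :=
  if a = .zero ∧ b = .zero then .zero else if a = .one ∨ b = .one then .one else .unk

/-- The type of the pair of cells `(2k, 2k + 1)`. -/
def block (k : ℤ) (η : Config) : Sym := kind (η (2 * k)) (η (2 * k + 1))

/-- The probability that a pair has type `c` when its cells are updated independently, from pairs
of types `a` and `b` respectively. As `rule` depends on its two arguments only through their type,
the row for a pair of type `a` is `rule p q a a`. -/
noncomputable def blockProb (p q : ℝ) (a b : Sym) : Sym → ℝ
  | .zero => rule p q a a .zero * rule p q b b .zero
  | .unk => (1 - rule p q a a .one) * (1 - rule p q b b .one) -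
      rule p q a a .zero * rule p q b b .zero
  | .one => 1 - (1 - rule p q a a .one) * (1 - rule p q b b .one)

theorem measurable_block (k : ℤ) : Measurable (block k) := by
  have hf : Measurable fun η : Config => (η (2 * k), η (2 * k + 1)) :=
    (measurable_pi_apply _).prodMk (measurable_pi_apply _)
  exact (measurable_of_countable fun x : Sym × Sym => kind x.1 x.2).comp hf

theorem rule_kind (p q : ℝ) (a b c : Sym) : rule p q (kind a b) (kind a b) c = rule p q a b c := by
  cases a <;> cases b <;> simp [kind, rule]

theorem cellLaw_kind (p q : ℝ) (a b : Sym) : cellLaw p q (kind a b) (kind a b) = cellLaw p q a b := by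
  simp only [cellLaw, rule_kind]

theorem rule_nonneg {p q : ℝ} (hp : 0 ≤ p) (hq : 0 ≤ q) (hpq : p + q ≤ 1) (a b c : Sym) :
    0 ≤ rule p q a b c := by
  unfold rule
  split_ifs <;> cases c <;> simp <;> linarith

theorem cellLaw_real_singleton {p q : ℝ} (hp : 0 ≤ p) (hq : 0 ≤ q) (hpq : p + q ≤ 1)
    (a b c : Sym) : (cellLaw p q a b).real {c} = rule p q a b c := by
  have h := rule_nonneg hp hq hpq a b c
  cases c <;> simp [cellLaw, measureReal_def, h]

/-- The types of the pairs of the updated configuration are independent. -/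
theorem step_map_block {p q : ℝ} (hp : 0 ≤ p) (hq : 0 ≤ q) (hpq : p + q ≤ 1) (η : Config) :
    (step p q η).map (fun ξ k => block k ξ) = Measure.infinitePi fun k : ℤ =>
      (Measure.infinitePi fun i : Bool => cellLaw p q (block (if i then k + 1 else k) η)
        (block (if i then k + 1 else k) η)).map fun u => kind (u false) (u true) := by
  have hprob := isProbabilityMeasure_cellLaw hp hq hpq
  -- Cell `2k + i` of the new configuration is the entry `i` of pair `k`.
  let φ : ℤ × Bool → ℤ := fun x => if x.2 then 2 * x.1 + 1 else 2 * x.1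
  have hφ : Function.Injective φ := by
    rintro ⟨a, i⟩ ⟨b, j⟩ h
    cases i <;> cases j <;> simp [φ] at h ⊢ <;> omega
  have hcell : ∀ k i, cellLaw p q (η (φ (k, i) + offset (φ (k, i))))
      (η (φ (k, i) + offset (φ (k, i)) + 1)) =
      cellLaw p q (block (if i then k + 1 else k) η) (block (if i then k + 1 else k) η) := by
    intro k i
    have h0 : offset (2 * k) = 0 := by simp [offset]
    have h1 : offset (2 * k + 1) = 1 := by simp [offset]
    rw [block, cellLaw_kind]
    cases i
    · simp [φ, h0]
    · simp only [φ, if_true, h1]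
      ring_nf
  have hm : Measurable fun u : Bool → Sym => kind (u false) (u true) := measurable_of_countable _
  have h := Measure.map_infinitePi_infinitePi_of_inj
    (P := fun n : ℤ => cellLaw p q (η (n + offset n)) (η (n + offset n + 1))) hφ
  have hc := Measure.infinitePi_map_curry fun (k : ℤ) (i : Bool) =>
    cellLaw p q (block (if i then k + 1 else k) η) (block (if i then k + 1 else k) η)
  have hpi := Measure.infinitePi_map_pi (fun k : ℤ => Measure.infinitePi fun i : Bool =>
    cellLaw p q (block (if i then k + 1 else k) η) (block (if i then k + 1 else k) η))
    (f := fun _ u => kind (u false) (u true)) (fun _ => hm)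
  rw [← hpi, ← hc]
  have h' : (fun x : ℤ × Bool => cellLaw p q (η (φ x + offset (φ x)))
      (η (φ x + offset (φ x) + 1))) = fun x : ℤ × Bool =>
      cellLaw p q (block (if x.2 then x.1 + 1 else x.1) η)
        (block (if x.2 then x.1 + 1 else x.1) η) := funext fun x => hcell x.1 x.2
  rw [h'] at h
  have hkind : Measurable fun (x : ℤ → Bool → Sym) (k : ℤ) => kind (x k false) (x k true) :=
    measurable_pi_lambda _ fun k => hm.comp (measurable_pi_apply k)
  rw [← h, Measure.map_map (by fun_prop) (by fun_prop),
    Measure.map_map (hkind.comp (by fun_prop)) (by fun_prop)]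
  rfl

/-- `blockProb` is the law of the type: being of type `zero`, and not being of type `one`, are both
product events. -/
theorem pair_real_kind {p q : ℝ} (hp : 0 ≤ p) (hq : 0 ≤ q) (hpq : p + q ≤ 1) (a : Bool → Sym)
    (c : Sym) :
    ((Measure.infinitePi fun i : Bool => cellLaw p q (a i) (a i)).map
      fun u => kind (u false) (u true)).real {c} = blockProb p q (a false) (a true) c := by
  have hprob := isProbabilityMeasure_cellLaw hp hq hpq
  rw [map_measureReal_apply (measurable_of_countable _) (by simp)]
  set P := Measure.infinitePi fun i : Bool => cellLaw p q (a i) (a i)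
  have hbox : ∀ s : Set Sym, P.real {u | u false ∈ s ∧ u true ∈ s} =
      (cellLaw p q (a false) (a false)).real s * (cellLaw p q (a true) (a true)).real s := by
    intro s
    have : {u : Bool → Sym | u false ∈ s ∧ u true ∈ s} =
        ((Finset.univ : Finset Bool) : Set Bool).pi fun _ => s := by
      ext u; simp [and_comm]
    rw [this, measureReal_def, Measure.infinitePi_pi _ (fun _ _ => .of_discrete)]
    simp [measureReal_def, mul_comm]
  have h0 := hbox {.zero}
  have h1 := hbox {.one}ᶜ
  simp only [probReal_compl_eq_one_sub (MeasurableSet.of_discrete (s := {Sym.one})),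
    cellLaw_real_singleton hp hq hpq] at h0 h1
  cases c
  · rw [blockProb, ← h0]
    congr 1
    ext u
    rcases hx : u false <;> rcases hy : u true <;> simp [kind, hx, hy]
  · rw [blockProb, ← h0, ← h1, ← measureReal_sdiff _ (.of_discrete)]
    · congr 1
      ext u
      rcases hx : u false <;> rcases hy : u true <;> simp [kind, hx, hy]
    · intro u
      simp +contextual
  · rw [blockProb, ← h1, ← probReal_compl_eq_one_sub .of_discrete]
    congr 1
    ext u
    rcases hx : u false <;> rcases hy : u true <;> simp [kind, hx, hy]

theorem step_real_blocks {p q : ℝ} (hp : 0 ≤ p) (hq : 0 ≤ q) (hpq : p + q ≤ 1) (η : Config)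
    (m : ℤ) (a b c : Sym) :
    (step p q η).real {ξ | block m ξ = a ∧ block (m + 1) ξ = b ∧ block (m + 2) ξ = c} =
      blockProb p q (block m η) (block (m + 1) η) a *
      blockProb p q (block (m + 1) η) (block (m + 2) η) b *
      blockProb p q (block (m + 2) η) (block (m + 3) η) c := by
  have hprob := isProbabilityMeasure_cellLaw hp hq hpq
  have hprob' : ∀ k : ℤ, IsProbabilityMeasure ((Measure.infinitePi fun i : Bool =>
      cellLaw p q (block (if i then k + 1 else k) η) (block (if i then k + 1 else k) η)).map
        fun u => kind (u false) (u true)) := fun k =>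
    Measure.isProbabilityMeasure_map (measurable_of_countable _).aemeasurable
  have hmeas : Measurable fun (ξ : Config) (k : ℤ) => block k ξ :=
    measurable_pi_lambda _ measurable_block
  let t : ℤ → Set Sym := fun k => if k = m then {a} else if k = m + 1 then {b} else {c}
  have hset : {ξ | block m ξ = a ∧ block (m + 1) ξ = b ∧ block (m + 2) ξ = c} =
      (fun (ξ : Config) (k : ℤ) => block k ξ) ⁻¹' (({m, m + 1, m + 2} : Finset ℤ) : Set ℤ).pi t := by
    ext ξ
    simp [t]
  rw [hset, ← map_measureReal_apply hmeas (MeasurableSet.pi (Finset.countable_toSet _)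
    fun _ _ => .of_discrete), step_map_block hp hq hpq, measureReal_def,
    Measure.infinitePi_pi _ (fun _ _ => .of_discrete), Finset.prod_insert (by simp),
    Finset.prod_insert (by simp), Finset.prod_singleton, ENNReal.toReal_mul, ENNReal.toReal_mul]
  simp only [← measureReal_def]
  have ht0 : t m = {a} := by simp [t]
  have ht1 : t (m + 1) = {b} := by simp [t]
  have ht2 : t (m + 2) = {c} := by simp [t]
  rw [ht0, ht1, ht2, pair_real_kind hp hq hpq (fun i => block (if i then m + 1 else m) η),
    pair_real_kind hp hq hpq (fun i => block (if i then m + 1 + 1 else m + 1) η),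
    pair_real_kind hp hq hpq (fun i => block (if i then m + 2 + 1 else m + 2) η), ← mul_assoc]
  norm_num [add_assoc]

/-! ### Stationary distributions and pair types -/

/-- The Markov operator of the pair types on functions of three consecutive types: the conditional
expectation of `f` after one update, given that four consecutive pairs have types `a`, `b`, `c`,
`d`. -/
noncomputable def transfer (p q : ℝ) (f : Sym → Sym → Sym → ℝ) (a b c d : Sym) : ℝ :=
  ∑ x, ∑ y, ∑ z, blockProb p q a b x * blockProb p q b c y * blockProb p q c d z * f x y z

theorem integrable_blocks (μ : Measure Config) [IsFiniteMeasure μ] (m : ℤ)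
    (f : Sym → Sym → Sym → Sym → ℝ) :
    Integrable (fun η => f (block m η) (block (m + 1) η) (block (m + 2) η) (block (m + 3) η)) μ := by
  have hf : Measurable fun x : Sym × Sym × Sym × Sym => f x.1 x.2.1 x.2.2.1 x.2.2.2 :=
    measurable_of_countable _
  refine Integrable.of_finite.comp_measurable (g := fun x : Sym × Sym × Sym × Sym =>
    f x.1 x.2.1 x.2.2.1 x.2.2.2) (f := fun η => (block m η, block (m + 1) η, block (m + 2) η,
      block (m + 3) η)) ?_
  exact (measurable_block _).prodMk ((measurable_block _).prodMk
    ((measurable_block _).prodMk (measurable_block _)))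

theorem IsStationary.real_eq_integral {p q : ℝ} (hp : 0 ≤ p) (hq : 0 ≤ q) (hpq : p + q ≤ 1)
    {μ : Measure Config} (h : IsStationary p q μ) {s : Set Config} (hs : MeasurableSet s) :
    μ.real s = ∫ η, (step p q η).real s ∂μ := by
  have hstep := isProbabilityMeasure_step hp hq hpq
  have hm := measurable_step hp hq hpq
  conv_lhs => rw [measureReal_def, ← h.2, push, Measure.bind_apply hs hm.aemeasurable]
  simp only [measureReal_def]
  rw [integral_toReal]
  · exact ((Measure.measurable_coe hs).comp hm).aemeasurable
  · exact .of_forall fun η => measure_lt_top _ _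

theorem IsStationary.integral_transfer {p q : ℝ} (hp : 0 ≤ p) (hq : 0 ≤ q) (hpq : p + q ≤ 1)
    {μ : Measure Config} (h : IsStationary p q μ) (f : Sym → Sym → Sym → ℝ) (m : ℤ) :
    ∫ η, f (block m η) (block (m + 1) η) (block (m + 2) η) ∂μ =
      ∫ η, transfer p q f (block m η) (block (m + 1) η) (block (m + 2) η) (block (m + 3) η) ∂μ := by
  have := h.1
  have hms : ∀ a b c, MeasurableSet
      {ξ : Config | block m ξ = a ∧ block (m + 1) ξ = b ∧ block (m + 2) ξ = c} := fun a b c =>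
    (measurable_block m (.of_discrete (s := {a}))).inter
      ((measurable_block (m + 1) (.of_discrete (s := {b}))).inter
        (measurable_block (m + 2) (.of_discrete (s := {c}))))
  have hleft : ∀ η, f (block m η) (block (m + 1) η) (block (m + 2) η) = ∑ a, ∑ b, ∑ c,
      Set.indicator {ξ : Config | block m ξ = a ∧ block (m + 1) ξ = b ∧ block (m + 2) ξ = c}
        (fun _ => f a b c) η := by
    intro η
    simp only [Set.indicator_apply, Set.mem_ofPred_eq]
    simp [ite_and, Finset.sum_ite_eq]
  simp_rw [hleft]
  simp only [transfer]
  have hint : ∀ a b c, Integrable (Set.indicator {ξ : Config | block m ξ = a ∧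
      block (m + 1) ξ = b ∧ block (m + 2) ξ = c} fun _ => f a b c) μ := fun a b c =>
    (integrable_const _).indicator (hms a b c)
  have hint' : ∀ a b c, Integrable (fun η => blockProb p q (block m η) (block (m + 1) η) a *
      blockProb p q (block (m + 1) η) (block (m + 2) η) b *
      blockProb p q (block (m + 2) η) (block (m + 3) η) c * f a b c) μ := fun a b c =>
    integrable_blocks μ m fun x y z w => blockProb p q x y a * blockProb p q y z b *
      blockProb p q z w c * f a b c
  rw [integral_finsetSum _ fun a _ => integrable_finsetSum _ fun b _ =>
      integrable_finsetSum _ fun c _ => hint a b c,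
    integral_finsetSum _ fun a _ => integrable_finsetSum _ fun b _ =>
      integrable_finsetSum _ fun c _ => hint' a b c]
  refine Finset.sum_congr rfl fun a _ => ?_
  rw [integral_finsetSum _ fun b _ => integrable_finsetSum _ fun c _ => hint a b c,
    integral_finsetSum _ fun b _ => integrable_finsetSum _ fun c _ => hint' a b c]
  refine Finset.sum_congr rfl fun b _ => ?_
  rw [integral_finsetSum _ fun c _ => hint a b c, integral_finsetSum _ fun c _ => hint' a b c]
  refine Finset.sum_congr rfl fun c _ => ?_
  rw [integral_indicator_const _ (hms a b c), h.real_eq_integral hp hq hpq (hms a b c),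
    integral_mul_const, smul_eq_mul]
  simp only [step_real_blocks hp hq hpq]

/-! ### The potential for `q = 0` -/

/-- The potential that decreases on average: a combination of the indicators of the words `?`,
`0?`, `?0`, `??`, `01?` and `?10` of pair types, read from the first letter `a`. Its coefficients,
and those of `corr`, are a rounded solution of the linear programme that
`transfer_weight_le` states; other choices would do. -/
noncomputable def weight (p : ℝ) (a b c : Sym) : ℝ :=
  (if a = .unk then 1200 + 2240 * p else 0) +
  (if (a = .zero ∧ b = .unk) ∨ (a = .unk ∧ b = .zero) then -320 else 0) +
  (if a = .unk ∧ b = .unk then -640 else 0) +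
  (if b = .one ∧ ((a = .zero ∧ c = .unk) ∨ (a = .unk ∧ c = .zero)) then 240 else 0)

/-- The corrector: a function of three consecutive pair types whose discrete gradient is added to
`weight`. After integration the gradient telescopes, in place of averaging over translations. -/
noncomputable def corr (p : ℝ) (a b c : Sym) : ℝ :=
  (if a = .unk then 430 + 840 * p else 0) + (if b = .unk then 70 else 0) +
  (if c = .unk then 39 else 0) + (if a = .unk ∧ b = .zero then 440 else 0) +
  (if a = .one ∧ b = .unk then 320 * p - 351 else 0) +
  (if a = .unk ∧ b = .unk then -120 else 0) + (if b = .unk ∧ c = .unk then -39 else 0)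

/-- By independence, each word indicator in `weight` is sent to a product of transition
probabilities, the letters that the word leaves free summing to one. -/
theorem transfer_weight (p : ℝ) (a b c d : Sym) :
    transfer p 0 (weight p) a b c d = (1200 + 2240 * p) * blockProb p 0 a b .unk
      - 320 * (blockProb p 0 a b .unk * blockProb p 0 b c .zero +
        blockProb p 0 a b .zero * blockProb p 0 b c .unk)
      - 640 * (blockProb p 0 a b .unk * blockProb p 0 b c .unk)
      + 240 * (blockProb p 0 a b .unk * blockProb p 0 b c .one * blockProb p 0 c d .zero +
        blockProb p 0 a b .zero * blockProb p 0 b c .one * blockProb p 0 c d .unk) := by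
  have h : ∀ x y, blockProb p 0 x y .one = 1 - blockProb p 0 x y .zero - blockProb p 0 x y .unk := by
    intro x y; simp only [blockProb]; ring
  simp only [transfer, sum_sym, weight, h, reduceCtorEq, if_true, if_false, and_true, and_false,
    true_and, false_and, or_false, false_or, or_self]
  ring

set_option maxHeartbeats 2000000 in
/-- The potential decreases, up to a discrete gradient, by at least the indicator that the first
pair has type `?`. In each of the 81 cases this is a polynomial inequality in `p` on
`[0.2145, 1]`. -/
theorem transfer_weight_le {p : ℝ} (hp : 0.2145 ≤ p) (hp1 : p ≤ 1) (a b c d : Sym) :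
    transfer p 0 (weight p) a b c d + (if a = .unk then 1 else 0) ≤
      weight p a b c + corr p b c d - corr p a b c := by
  rw [transfer_weight]
  have h0 : 0 ≤ p := by linarith
  have h1 : 0 ≤ p - 0.2145 := by linarith
  have h2 : 0 ≤ 1 - p := by linarith
  have h3 := mul_nonneg h1 h2
  -- The polynomials have degree at most 6; the squares are centred near the interior minima of the
  -- tightest of them.
  cases a <;> cases b <;> cases c <;> cases d <;>
    simp only [blockProb, rule, weight, corr, reduceCtorEq, if_true, if_false, and_true,
      and_false, or_false, or_true, and_self, or_self] <;>
    first
    | nlinarith only [hp, hp1]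
    | nlinarith only [hp, hp1, h3, sq_nonneg (p - 0.26), sq_nonneg (p - 0.4)]
    | nlinarith only [hp, hp1, h3, sq_nonneg (p - 0.26), mul_nonneg h3 h0,
        mul_nonneg h1 (sq_nonneg (p - 0.4)), mul_nonneg h1 (sq_nonneg (p - 0.3)),
        mul_nonneg h2 (sq_nonneg (p - 0.3))]

/-! ### From pair types back to cells -/

theorem measurableSet_block_eq (m : ℤ) (a : Sym) : MeasurableSet {η | block m η = a} :=
  measurable_block m (.of_discrete (s := {a}))

theorem integral_block_unk (μ : Measure Config) (m : ℤ) :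
    ∫ η, (if block m η = .unk then 1 else 0 : ℝ) ∂μ = μ.real {η | block m η = .unk} := by
  rw [← integral_indicator_one (measurableSet_block_eq m .unk)]
  simp only [Set.indicator_apply, Set.mem_ofPred_eq, Pi.one_apply]

/-- A cell turns into `?` only if the pair it is updated from has type `?`. -/
theorem step_real_unk_eq_zero {p q : ℝ} (hp : 0 ≤ p) (hq : 0 ≤ q) (hpq : p + q ≤ 1) {η : Config}
    (h : ∀ m, block m η ≠ .unk) (n : ℤ) : (step p q η).real {ξ | ξ n = .unk} = 0 := by
  -- Every cell is updated from a pair whose left entry is even.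
  obtain ⟨k, hk⟩ : ∃ k, n + offset n = 2 * k := by
    unfold offset
    split_ifs with hn
    · obtain ⟨k, rfl⟩ := hn
      exact ⟨k, by ring⟩
    · obtain ⟨k, rfl⟩ := Int.not_even_iff_odd.1 hn
      exact ⟨k + 1, by ring⟩
  have hset : {ξ : Config | ξ n = .unk} = (({n} : Finset ℤ) : Set ℤ).pi fun _ => {.unk} := by
    ext ξ
    simp
  rw [hset, measureReal_def, step_pi hp hq hpq, Finset.prod_singleton, ← measureReal_def,
    cellLaw_real_singleton hp hq hpq, hk, ← rule_kind]
  have hb := h k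
  change rule p q (block k η) (block k η) .unk = 0
  rcases hc : block k η <;> simp_all [rule]

theorem IsStationary.exists_unk_eq_zero {p q : ℝ} (hp : 0 ≤ p) (hq : 0 ≤ q) (hpq : p + q ≤ 1)
    {μ : Measure Config} (h : IsStationary p q μ) (h0 : ∀ m, μ.real {η | block m η = .unk} = 0) :
    μ {η | ∃ n, η n = .unk} = 0 := by
  have := h.1
  have hae : ∀ᵐ η ∂μ, ∀ m, block m η ≠ .unk :=
    ae_all_iff.2 fun m => measure_eq_zero_iff_ae_notMem.1 ((measureReal_eq_zero_iff).1 (h0 m))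
  have hset : {η : Config | ∃ n, η n = .unk} = ⋃ n, {η : Config | η n = .unk} := by
    ext η
    simp
  rw [hset]
  refine measure_iUnion_null fun n => (measureReal_eq_zero_iff).1 ?_
  have hmeas : MeasurableSet {η : Config | η n = .unk} :=
    (measurable_pi_apply (X := fun _ : ℤ => Sym) n) (.of_discrete (s := {Sym.unk}))
  rw [h.real_eq_integral hp hq hpq hmeas]
  refine integral_eq_zero_of_ae ?_
  filter_upwards [hae] with η hη using step_real_unk_eq_zero hp hq hpq hη n

/-! ### Two vanishing criteria on `ℤ` -/

theorem eq_zero_of_le_mul_add_succ {u : ℤ → ℝ} {c : ℝ} (hc : 0 ≤ c) (hc1 : 2 * c < 1)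
    (h0 : ∀ m, 0 ≤ u m) (hb : BddAbove (Set.range u)) (h : ∀ m, u m ≤ c * (u m + u (m + 1)))
    (m : ℤ) : u m = 0 := by
  have hle : ∀ m, u m ≤ ⨆ m, u m := le_ciSup hb
  have hs : ⨆ m, u m ≤ 2 * c * ⨆ m, u m := ciSup_le fun m => by
    nlinarith [h m, mul_le_mul_of_nonneg_left (add_le_add (hle m) (hle (m + 1))) hc]
  nlinarith [hle m, h0 m]

/-- A nonnegative function on `ℤ` vanishes if it is bounded by the increments of a bounded function
that is itself controlled by nearby values of the first. -/
theorem eq_zero_of_le_sub {u G : ℤ → ℝ} {C : ℝ} (h0 : ∀ m, 0 ≤ u m) (hb : ∃ B, ∀ m, |G m| ≤ B)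
    (hG : ∀ m, |G m| ≤ C * (u m + u (m + 1) + u (m + 2))) (h : ∀ m, u m ≤ G (m + 1) - G m)
    (m : ℤ) : u m = 0 := by
  obtain ⟨B, hB⟩ := hb
  have hmono : Monotone G := monotone_int_of_le_succ fun m => by linarith [h m, h0 m]
  -- If `G` has a limit along `l`, its increments tend to zero, so `u` and with it `G` do.
  have key : ∀ l : Filter ℤ, (∀ k, Filter.Tendsto (fun m => m + k) l l) →
      (∃ L, Filter.Tendsto G l (nhds L)) → Filter.Tendsto G l (nhds 0) := by
    rintro l hl ⟨L, hL⟩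
    have hu : Filter.Tendsto u l (nhds 0) := by
      refine squeeze_zero h0 h ?_
      simpa using (hL.comp (hl 1)).sub hL
    refine squeeze_zero_norm hG ?_
    simpa using ((hu.add (hu.comp (hl 1))).add (hu.comp (hl 2))).const_mul C
  have htop := key Filter.atTop (fun k => Filter.tendsto_atTop_add_const_right _ k Filter.tendsto_id)
    ⟨_, tendsto_atTop_ciSup hmono ⟨B, by rintro _ ⟨m, rfl⟩; exact (abs_le.1 (hB m)).2⟩⟩
  have hbot := key Filter.atBot (fun k => Filter.tendsto_atBot_add_const_right _ k Filter.tendsto_id)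
    ⟨_, tendsto_atBot_ciInf hmono ⟨-B, by rintro _ ⟨m, rfl⟩; exact (abs_le.1 (hB m)).1⟩⟩
  linarith [h m, h0 m, hmono.ge_of_tendsto htop (m + 1), hmono.le_of_tendsto hbot m]

/-! ### Pairs of type `?` have probability zero -/

/-- A new pair of type `?` has an entry `?`, inherited from an old pair of type `?` with probability
`1 - p - q`, and an independent entry different from `1`. -/
theorem blockProb_unk_le {p q : ℝ} (hp : 0 ≤ p) (hq : 0 ≤ q) (hpq : p + q ≤ 1) (a b : Sym) :
    blockProb p q a b .unk ≤ (1 - q) * (1 - p - q) *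
      ((if a = .unk then 1 else 0) + (if b = .unk then 1 else 0)) := by
  have h1 : 0 ≤ 1 - p - q := by linarith
  have h2 := mul_nonneg hp h1
  have h3 := mul_nonneg hq h1
  have h4 := mul_nonneg h1 h1
  cases a <;> cases b <;> simp [blockProb, rule] <;> nlinarith

theorem sum_blockProb (p q : ℝ) (a b : Sym) : ∑ c, blockProb p q a b c = 1 := by
  simp only [sum_sym, blockProb]
  ring

theorem IsStationary.block_unk_eq_zero_of_lt {p q : ℝ} (hp : 0 ≤ p) (hq : 0 ≤ q) (hpq : p + q ≤ 1)
    (hc : 2 * ((1 - q) * (1 - p - q)) < 1) {μ : Measure Config} (h : IsStationary p q μ) (m : ℤ) :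
    μ.real {η | block m η = .unk} = 0 := by
  have := h.1
  refine eq_zero_of_le_mul_add_succ (u := fun m => μ.real {η | block m η = .unk})
    (mul_nonneg (by linarith) (by linarith)) hc (fun m => measureReal_nonneg)
    ⟨1, by rintro _ ⟨m, rfl⟩; exact measureReal_le_one⟩ (fun m => ?_) m
  have ht := h.integral_transfer hp hq hpq (fun a _ _ => if a = .unk then 1 else 0) m
  simp only [← integral_block_unk]
  have hi : ∀ k, Integrable (fun η => (if block k η = .unk then 1 else 0 : ℝ)) μ := fun k =>
    integrable_blocks μ k fun a _ _ _ => if a = .unk then 1 else 0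
  refine ht.le.trans ?_
  rw [← integral_add (hi _) (hi _), ← integral_const_mul]
  refine integral_mono (integrable_blocks μ m _) (((hi _).add (hi _)).const_mul _) fun η => ?_
  refine le_trans (le_of_eq ?_) (blockProb_unk_le hp hq hpq _ _)
  simp only [transfer, mul_ite, mul_one, mul_zero]
  simp [← Finset.mul_sum, sum_blockProb]

theorem abs_corr_le {p : ℝ} (hp : 0 ≤ p) (hp1 : p ≤ 1) (a b c : Sym) :
    |corr p a b c| ≤ 2000 * ((if a = .unk then 1 else 0) + (if b = .unk then 1 else 0) +
      (if c = .unk then 1 else 0)) := by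
  rw [abs_le]
  cases a <;> cases b <;> cases c <;> simp [corr] <;> constructor <;> linarith

theorem IsStationary.block_unk_eq_zero_of_weight {p : ℝ} (hp : 0.2145 ≤ p) (hp1 : p ≤ 1)
    {μ : Measure Config} (h : IsStationary p 0 μ) (m : ℤ) :
    μ.real {η | block m η = .unk} = 0 := by
  have := h.1
  have hp0 : 0 ≤ p := by linarith
  have hi : ∀ k, Integrable (fun η => (if block k η = .unk then 1 else 0 : ℝ)) μ := fun k =>
    integrable_blocks μ k fun a _ _ _ => if a = .unk then 1 else 0
  have hcorr : ∀ k, Integrable (fun η => corr p (block k η) (block (k + 1) η) (block (k + 2) η)) μ :=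
    fun k => integrable_blocks μ k fun a b c _ => corr p a b c
  have hC : ∀ k, |∫ η, corr p (block k η) (block (k + 1) η) (block (k + 2) η) ∂μ| ≤
      2000 * (μ.real {η | block k η = .unk} + μ.real {η | block (k + 1) η = .unk} +
        μ.real {η | block (k + 2) η = .unk}) := by
    intro k
    refine abs_integral_le_integral_abs.trans ?_
    simp only [← integral_block_unk]
    rw [← integral_add' (hi _) (hi _), ← integral_add' ((hi _).add (hi _)) (hi _),
      ← integral_const_mul]
    exact integral_mono (hcorr k).abs ((((hi _).add (hi _)).add (hi _)).const_mul _)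
      fun η => abs_corr_le hp0 hp1 _ _ _
  refine eq_zero_of_le_sub (u := fun m => μ.real {η | block m η = .unk})
    (G := fun k => ∫ η, corr p (block k η) (block (k + 1) η) (block (k + 2) η) ∂μ)
    (fun m => measureReal_nonneg) ⟨6000, fun k => (hC k).trans ?_⟩ hC (fun k => ?_) m
  · linarith [measureReal_le_one (μ := μ) (s := {η | block k η = .unk}),
      measureReal_le_one (μ := μ) (s := {η | block (k + 1) η = .unk}),
      measureReal_le_one (μ := μ) (s := {η | block (k + 2) η = .unk})]
  · have ht := h.integral_transfer hp0 le_rfl (by linarith) (weight p) k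
    have hw : Integrable (fun η => weight p (block k η) (block (k + 1) η) (block (k + 2) η)) μ :=
      integrable_blocks μ k fun a b c _ => weight p a b c
    have htr : Integrable (fun η => transfer p 0 (weight p) (block k η) (block (k + 1) η)
        (block (k + 2) η) (block (k + 3) η)) μ := integrable_blocks μ k _
    have hc1 := hcorr (k + 1)
    rw [show k + 1 + 1 = k + 2 by ring, show k + 1 + 2 = k + 3 by ring] at hc1
    have hle := integral_mono (htr.add (hi k)) ((hw.add hc1).sub (hcorr k)) fun η =>
      transfer_weight_le hp hp1 (block k η) (block (k + 1) η) (block (k + 2) η) (block (k + 3) η)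
    rw [integral_add' htr (hi k), integral_sub' (hw.add hc1) (hcorr k), integral_add' hw hc1,
      integral_block_unk] at hle
    rw [show k + 1 + 1 = k + 2 by ring, show k + 1 + 2 = k + 3 by ring]
    linarith

/-! ### The root of the quintic -/

theorem strictMono_quintic :
    StrictMono fun x : ℝ => x ^ 5 - 5 * x ^ 4 + 9 * x ^ 3 - 8 * x ^ 2 + 6 * x - 1 := by
  refine strictMono_of_deriv_pos fun x => ?_
  have hd : HasDerivAt (fun x : ℝ => x ^ 5 - 5 * x ^ 4 + 9 * x ^ 3 - 8 * x ^ 2 + 6 * x - 1)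
      (5 * x ^ 4 - 20 * x ^ 3 + 27 * x ^ 2 - 16 * x + 6) x := by
    have h := ((((((hasDerivAt_id x).pow 5).sub (((hasDerivAt_id x).pow 4).const_mul 5)).add
      (((hasDerivAt_id x).pow 3).const_mul 9)).sub (((hasDerivAt_id x).pow 2).const_mul 8)).add
      ((hasDerivAt_id x).const_mul 6)).sub_const 1
    refine h.congr_deriv ?_
    simp
    ring
  rw [hd.deriv]
  nlinarith [sq_nonneg (x ^ 2 - 2 * x + 0.6), sq_nonneg (x - 1.7)]

end EnvelopeGPCA

theorem theorem2 :
    ∃ p₀ : ℝ,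
      (∀ x : ℝ, x ^ 5 - 5 * x ^ 4 + 9 * x ^ 3 - 8 * x ^ 2 + 6 * x - 1 = 0 ↔ x = p₀) ∧
      |p₀ - 0.215| < 0.0005 ∧
      ∀ p q : ℝ, 0 ≤ p → 0 ≤ q → 0 < p + q → p + q ≤ 1 →
        (q = 0 ∧ p₀ < p) ∨ max ((-√(p ^ 2 + 2) - p + 2) / 2) 0 < q →
        ¬ ∃ μ : MeasureTheory.Measure EnvelopeGPCA.Config,
          EnvelopeGPCA.IsStationary p q μ ∧
            0 < μ {η | ∃ n : ℤ, η n = EnvelopeGPCA.Sym.unk} := by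
  have hmono := EnvelopeGPCA.strictMono_quintic
  obtain ⟨p₀, ⟨hlo, hhi⟩, hroot⟩ := intermediate_value_Ioo (a := (0.2145 : ℝ)) (b := 0.2155)
    (by norm_num)
    (f := fun x : ℝ => x ^ 5 - 5 * x ^ 4 + 9 * x ^ 3 - 8 * x ^ 2 + 6 * x - 1) (by fun_prop)
    (show (0 : ℝ) ∈ _ by constructor <;> norm_num)
  refine ⟨p₀, fun x => ⟨fun hx => hmono.injective (hx.trans hroot.symm), ?_⟩, ?_, ?_⟩
  · rintro rfl
    exact hroot
  · rw [abs_lt]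
    constructor <;> linarith
  · rintro p q hp hq - hpq hcase ⟨μ, hμ, hpos⟩
    refine hpos.ne' (hμ.exists_unk_eq_zero hp hq hpq ?_)
    rcases hcase with ⟨rfl, hp₀⟩ | hmax
    · exact hμ.block_unk_eq_zero_of_weight (by linarith) (by linarith)
    · refine hμ.block_unk_eq_zero_of_lt hp hq hpq ?_
      have h1 := (le_max_left _ _).trans_lt hmax
      have h2 : 2 - p - 2 * q < √(p ^ 2 + 2) := by linarith
      -- Squared, this is `2 * (1 - q) * (1 - p - q) < 1`; the left side of `h2` is
      -- `(1 - q) + (1 - p - q)`, which is nonnegative.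
      have h3 := (Real.lt_sqrt (by linarith)).1 h2
      nlinarith
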